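/- Let $\tilde 1:\mathbb{R}\to\mathbb{C}$ be a $C^\infty$ function supported in $[-1/2,1/2]$. For a compact interval $I=[c_I-|I|/2,\,c_I+|I|/2]$ of positive length put $\tilde 1_I(\xi)=\tilde 1(|I|^{-1}(\xi-c_I))$, and let $\mathcal{F}^{-1}[g](x)=\int_{\mathbb{R}} g(\xi)e^{2\pi i x\xi}\,d\xi$. Define $$\mathcal{V}^{res}_2 f(x)=\sup_{R>0}\ \sup_{0\le\alpha<R}\ \Big(\sum_{j\in\mathbb{Z}}\big|f*\mathcal{F}^{-1}\big[\tilde 1_{[\alpha+jR,\,\alpha+(j+1)R]}\big](x)\big|^2\Big)^{1/2}\in[0,\infty].$$ Then $\mathcal{V}^{res}_2$ maps $L^p(\mathbb{R})$ boundedly into $L^p(\mathbb{R})$ for all $2<p<\infty$. That is, for every such $p$ there is a finite constant $C$, depending only on $p$ and $\tilde 1$, such that for every complex-valued $f\in L^p(\mathbb{R})$ the integrals defining the convolutions $f*\mathcal{F}^{-1}[\tilde 1_I](x)$ converge absolutely for all $I$ and all $x\in\mathbb{R}$, the function $\mathcal{V}^{res}_2 f$ is in $L^p(\mathbb{R})$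 (in particular it is measurable and finite almost everywhere), and $$\|\mathcal{V}^{res}_2 f\|_{L^p(\mathbb{R})}\le C\,\|f\|_{L^p(\mathbb{R})}.$$ -/

import Mathlib

open MeasureTheory Set
open scoped ENNReal NNReal ContDiff FourierTransform Convolution

noncomputable section

/-- The function `φ_I(x) = φ (|I|⁻¹ (x - c_I))` for the interval `I = [a, b]`,
where `c_I = (a + b) / 2` is the centre of `I` and `|I| = b - a` its length. -/
def intervalBump (φ : ℝ → ℂ) (a b : ℝ) (x : ℝ) : ℂ :=
  φ ((b - a)⁻¹ * (x - (a + b) / 2))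

/-- The convolution kernel `𝓕⁻¹[φ_I]` for `I = [a, b]`, with
`𝓕⁻¹[g](x) = ∫ g(ξ) e^{2πixξ} dξ`. -/
def intervalKernel (φ : ℝ → ℂ) (a b : ℝ) : ℝ → ℂ :=
  𝓕⁻ (intervalBump φ a b)

/-- The frequency localisation `f * 𝓕⁻¹[φ_I]` for `I = [a, b]`. -/
def freqPiece (φ f : ℝ → ℂ) (a b : ℝ) : ℝ → ℂ :=
  f ⋆[ContinuousLinearMap.mul ℂ ℂ, volume] intervalKernel φ a b

/-- The square function `(∑_{j ∈ ℤ} |f * 𝓕⁻¹[φ_{[α+jR, α+(j+1)R]}](x)|²)^{1/2}`,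
with values in `[0, ∞]`. -/
def shiftedSquareFunction (φ f : ℝ → ℂ) (R α : ℝ) (x : ℝ) : ℝ≥0∞ :=
  (∑' j : ℤ, ‖freqPiece φ f (α + j * R) (α + (j + 1) * R) x‖ₑ ^ 2) ^ (1 / 2 : ℝ)

/-- The smooth restricted 2-variation of `f`: the supremum of the shifted square functions over
all `R > 0` and `0 ≤ α < R`. -/
def restrictedVariation (φ f : ℝ → ℂ) (x : ℝ) : ℝ≥0∞ :=
  ⨆ (R : ℝ) (_ : 0 < R) (α : ℝ) (_ : α ∈ Ico 0 R), shiftedSquareFunction φ f R α x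

end

/-! The square of the shifted square function is bounded pointwise by a constant times `M(|f|²)(x)`,
uniformly in `R` and `α`; so the supremum costs nothing, and the maximal inequality on `L^{p/2}`,
with `p/2 > 1`, concludes.

For the pointwise bound, put `s = R(x - t)` in the convolution: the `j`-th piece becomes `∫
e^{2πijs} G(s) ds` with `G` independent of `j` (`freqPiece_eq`). The characters form an orthonormal
basis on each cell `(n, n+1]`, so Parseval on cells and a weighted Cauchy–Schwarz over `n` bound the
sum over `j` by weighted `L²` masses of `G` (`tsum_sq_enorm_integral_exp_mul_le`). Since `|G(s)|` is
`|f(x - s/R)|` times a rapidly decaying factor, these masses are controlled by averages of `|f|²`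
around `x` (`sq_shiftedSquareFunction_le`). -/

/-! ### The Hardy–Littlewood maximal inequality. -/

/-- The uncentred Hardy–Littlewood maximal function on the real line. -/
noncomputable def maximalFunction (h : ℝ → ℝ≥0∞) (x : ℝ) : ℝ≥0∞ :=
  ⨆ (c : ℝ) (r : ℝ) (_ : 0 < r), (Metric.ball c r).indicator
    (fun _ => (∫⁻ y in Metric.ball c r, h y) / ENNReal.ofReal (2 * r)) x

/-- Uncentred open balls make this a supremum of indicators of open sets, so `h` need not be
measurable. -/
theorem lowerSemicontinuous_maximalFunction (h : ℝ → ℝ≥0∞) :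
    LowerSemicontinuous (maximalFunction h) :=
  lowerSemicontinuous_iSup fun _ => lowerSemicontinuous_iSup fun _ =>
    lowerSemicontinuous_iSup fun _ => Metric.isOpen_ball.lowerSemicontinuous_indicator zero_le

theorem measurable_maximalFunction (h : ℝ → ℝ≥0∞) : Measurable (maximalFunction h) :=
  (lowerSemicontinuous_maximalFunction h).measurable

theorem setLIntegral_ball_le_maximalFunction (h : ℝ → ℝ≥0∞) {x c r : ℝ} (hr : 0 < r)
    (hx : x ∈ Metric.ball c r) :
    ∫⁻ y in Metric.ball c r, h y ≤ ENNReal.ofReal (2 * r) * maximalFunction h x := by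
  have h0 : ENNReal.ofReal (2 * r) ≠ 0 := by simpa using hr
  rw [mul_comm, ← ENNReal.div_le_iff h0 ENNReal.ofReal_ne_top]
  refine le_iSup_of_le c (le_iSup_of_le r (le_iSup_of_le hr ?_))
  rw [indicator_of_mem hx]

theorem exists_ball_of_lt_maximalFunction {h : ℝ → ℝ≥0∞} {x : ℝ} {t : ℝ≥0∞}
    (ht : t < maximalFunction h x) :
    ∃ c r : ℝ, 0 < r ∧ x ∈ Metric.ball c r ∧
      t * ENNReal.ofReal (2 * r) < ∫⁻ y in Metric.ball c r, h y := by
  simp only [maximalFunction, lt_iSup_iff] at ht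
  obtain ⟨c, r, hr, hlt⟩ := ht
  have hx : x ∈ Metric.ball c r := by
    by_contra hx
    rw [indicator_of_notMem hx] at hlt
    exact not_lt_bot hlt
  rw [indicator_of_mem hx] at hlt
  exact ⟨c, r, hr, hx, ENNReal.mul_lt_of_lt_div hlt⟩

theorem maximalFunction_congr_ae {h h' : ℝ → ℝ≥0∞} (hh : h =ᵐ[volume] h') :
    maximalFunction h = maximalFunction h' := by
  funext x
  simp only [maximalFunction]
  congr! 8 with c r hr
  exact lintegral_congr_ae (ae_restrict_of_ae hh)

/-- The weak type `(1, 1)` inequality. -/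
theorem mul_volume_lt_maximalFunction_le (h : ℝ → ℝ≥0∞) {t : ℝ} (ht : 0 < t) :
    ENNReal.ofReal t * volume {x | ENNReal.ofReal t < maximalFunction h x}
      ≤ 5 * ∫⁻ y, h y := by
  by_cases hfin : ∫⁻ y, h y = ⊤
  · simp [hfin]
  let S : Set (ℝ × ℝ) := {a | 0 < a.2 ∧
    ENNReal.ofReal t * ENNReal.ofReal (2 * a.2) < ∫⁻ y in Metric.ball a.1 a.2, h y}
  -- Finite total mass bounds the radii, as the Vitali covering lemma requires.
  have hS : ∀ a ∈ S, a.2 ≤ (∫⁻ y, h y).toReal / t := by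
    intro a ha
    have h1 := ha.2.le.trans (setLIntegral_le_lintegral _ _)
    rw [← ENNReal.ofReal_mul ht.le] at h1
    have h2 := (ENNReal.ofReal_le_iff_le_toReal hfin).1 h1
    rw [le_div_iff₀ ht]
    nlinarith [mul_pos ht ha.1]
  obtain ⟨u, huS, hdisj, hcov⟩ := Vitali.exists_disjoint_subfamily_covering_enlargement_closedBall
    S Prod.fst Prod.snd _ hS 5 (by norm_num)
  have hcount : u.Countable := hdisj.countable_of_nonempty_interior fun a ha =>
    ⟨a.1, Metric.ball_subset_interior_closedBall (Metric.mem_ball_self (huS ha).1)⟩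
  have hsub : {x | ENNReal.ofReal t < maximalFunction h x} ⊆
      ⋃ a ∈ u, Metric.closedBall a.1 (5 * a.2) := by
    intro x hx
    obtain ⟨c, r, hr, hxc, hlt⟩ := exists_ball_of_lt_maximalFunction hx
    obtain ⟨b, hb, hsub⟩ := hcov (c, r) ⟨hr, hlt⟩
    exact mem_biUnion hb (hsub (Metric.ball_subset_closedBall hxc))
  calc ENNReal.ofReal t * volume {x | ENNReal.ofReal t < maximalFunction h x}
      ≤ ENNReal.ofReal t * ∑' a : u, volume (Metric.closedBall a.1.1 (5 * a.1.2)) := by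
        gcongr
        exact (measure_mono hsub).trans (measure_biUnion_le _ hcount _)
    _ = ∑' a : u, 5 * (ENNReal.ofReal t * ENNReal.ofReal (2 * a.1.2)) := by
        rw [← ENNReal.tsum_mul_left]
        refine tsum_congr fun a => ?_
        rw [Real.volume_closedBall, show 2 * (5 * a.1.2) = 5 * (2 * a.1.2) by ring,
          ENNReal.ofReal_mul (by norm_num)]
        simp only [ENNReal.ofReal_ofNat]
        ring
    _ ≤ ∑' a : u, 5 * ∫⁻ y in Metric.closedBall a.1.1 a.1.2, h y := by
        gcongr with a
        exact (huS a.2).2.le.trans (lintegral_mono_set Metric.ball_subset_closedBall)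
    _ = 5 * ∫⁻ y in ⋃ a ∈ u, Metric.closedBall a.1 a.2, h y := by
        rw [ENNReal.tsum_mul_left, lintegral_biUnion hcount
          (fun _ _ => Metric.isClosed_closedBall.measurableSet) hdisj]
    _ ≤ 5 * ∫⁻ y, h y := mul_le_mul_right (setLIntegral_le_lintegral _ _) _

theorem setLIntegral_rpow_indicator_Ioi {r : ℝ} (hr : 0 < r) (y : ℝ≥0∞) :
    ∫⁻ t in Ioi (0 : ℝ), ENNReal.ofReal (t ^ (r - 1)) *
      (Ioi (ENNReal.ofReal t)).indicator 1 y = y ^ r / ENNReal.ofReal r := by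
  have hr0 : ENNReal.ofReal r ≠ 0 := by simpa using hr
  have key : ∀ b : ℝ≥0, ∫⁻ t in Ioi (0 : ℝ), ENNReal.ofReal (t ^ (r - 1)) *
      (Ioi (ENNReal.ofReal t)).indicator 1 (b : ℝ≥0∞) =
        (b : ℝ≥0∞) ^ r / ENNReal.ofReal r := by
    intro b
    -- The layer-cake formula for a constant function against a Dirac mass is the identity for one
    -- number.
    have h := lintegral_rpow_eq_lintegral_meas_lt_mul (Measure.dirac (0 : ℝ))
      (f := fun _ => (b : ℝ)) (ae_of_all _ fun _ => b.2) aemeasurable_const hr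
    rw [lintegral_const, measure_univ, mul_one,
      ← ENNReal.ofReal_rpow_of_nonneg b.coe_nonneg hr.le, ENNReal.ofReal_coe_nnreal] at h
    rw [h, mul_comm, ENNReal.mul_div_cancel_right hr0 ENNReal.ofReal_ne_top]
    refine setLIntegral_congr_fun measurableSet_Ioi fun t ht => ?_
    rw [mul_comm]
    congr 1
    have : (ENNReal.ofReal t < (b : ℝ≥0∞)) ↔ t < b := by
      rw [← ENNReal.ofReal_coe_nnreal, ENNReal.ofReal_lt_ofReal_iff_of_nonneg (le_of_lt ht)]
    by_cases hb : t < b <;> simp [indicator, this, hb]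
  induction y using ENNReal.recTopCoe with
  | coe b => exact key b
  | top =>
    rw [ENNReal.top_rpow_of_pos hr, ENNReal.top_div_of_ne_top ENNReal.ofReal_ne_top]
    refine ENNReal.eq_top_of_forall_nnreal_le fun b => ?_
    -- Chosen so that the finite case returns exactly `b`, for arbitrary `b`.
    have hb := key ((b * r.toNNReal) ^ r⁻¹)
    rw [ENNReal.coe_rpow_of_nonneg _ (inv_nonneg.2 hr.le), ENNReal.rpow_inv_rpow hr.ne',
      ENNReal.coe_mul, ← ENNReal.ofReal, ENNReal.mul_div_cancel_right hr0 ENNReal.ofReal_ne_top]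
      at hb
    rw [← hb]
    refine lintegral_mono fun t => ?_
    gcongr
    simp only [indicator, mem_Ioi, ENNReal.ofReal_lt_top, if_true]
    split_ifs <;> simp

/-- The part of `h` below `t/2` adds at most `t/2` to any average, so where `Mh > t` the part above
has maximal function exceeding `t/2`; the weak type bound applies to that part. -/
theorem volume_lt_maximalFunction_le (h : ℝ → ℝ≥0∞) {t : ℝ} (ht : 0 < t) :
    ENNReal.ofReal t * volume {x | ENNReal.ofReal t < maximalFunction h x}
      ≤ 10 * ∫⁻ y, h y * (Ioi (ENNReal.ofReal t)).indicator 1 (2 * h y) := by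
  set g : ℝ → ℝ≥0∞ := fun y => h y * (Ioi (ENNReal.ofReal t)).indicator 1 (2 * h y) with hg
  have h2 : ENNReal.ofReal t = 2 * ENNReal.ofReal (t / 2) := by
    rw [← ENNReal.ofReal_ofNat, ← ENNReal.ofReal_mul (by norm_num)]
    congr 1
    ring
  have hle : ∀ y, h y ≤ g y + ENNReal.ofReal (t / 2) := by
    intro y
    by_cases hy : ENNReal.ofReal t < 2 * h y
    · simp [hg, indicator, hy]
    · have : h y ≤ ENNReal.ofReal (t / 2) := by
        rw [not_lt, h2] at hy
        exact (ENNReal.mul_le_mul_iff_right (by simp) (by simp)).1 hy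
      exact this.trans le_add_self
  have hsub : {x | ENNReal.ofReal t < maximalFunction h x} ⊆
      {x | ENNReal.ofReal (t / 2) < maximalFunction g x} := by
    intro x hx
    obtain ⟨c, r, hr, hxc, hlt⟩ := exists_ball_of_lt_maximalFunction hx
    by_contra hcon
    rw [mem_ofPred_eq, not_lt] at hcon
    refine hlt.not_ge ?_
    calc ∫⁻ y in Metric.ball c r, h y
        ≤ ∫⁻ y in Metric.ball c r, (g y + ENNReal.ofReal (t / 2)) := lintegral_mono hle
      _ = (∫⁻ y in Metric.ball c r, g y) + ENNReal.ofReal (t / 2) * ENNReal.ofReal (2 * r) := by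
        rw [lintegral_add_right _ measurable_const, setLIntegral_const, Real.volume_ball]
      _ ≤ ENNReal.ofReal (2 * r) * ENNReal.ofReal (t / 2) +
          ENNReal.ofReal (t / 2) * ENNReal.ofReal (2 * r) := by
        gcongr
        exact (setLIntegral_ball_le_maximalFunction g hr hxc).trans (by gcongr)
      _ = ENNReal.ofReal t * ENNReal.ofReal (2 * r) := by rw [h2]; ring
  calc ENNReal.ofReal t * volume {x | ENNReal.ofReal t < maximalFunction h x}
      ≤ ENNReal.ofReal t * volume {x | ENNReal.ofReal (t / 2) < maximalFunction g x} := by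
        gcongr
    _ = 2 * (ENNReal.ofReal (t / 2) *
          volume {x | ENNReal.ofReal (t / 2) < maximalFunction g x}) := by rw [h2, mul_assoc]
    _ ≤ 2 * (5 * ∫⁻ y, g y) :=
        mul_le_mul_right (mul_volume_lt_maximalFunction_le g (by positivity)) _
    _ = 10 * ∫⁻ y, g y := by rw [← mul_assoc]; norm_num

theorem Measurable.indicator_Ioi {α : Type*} [MeasurableSpace α] {f g : α → ℝ≥0∞}
    (hf : Measurable f) (hg : Measurable g) :
    Measurable fun a => (Ioi (f a)).indicator (1 : ℝ≥0∞ → ℝ≥0∞) (g a) := by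
  have : (fun a => (Ioi (f a)).indicator (1 : ℝ≥0∞ → ℝ≥0∞) (g a)) = {a | f a < g a}.indicator 1 := by
    ext a
    simp [Set.indicator]
  rw [this]
  exact measurable_one.indicator (measurableSet_lt hf hg)

/-- The Hardy–Littlewood maximal inequality on `L^q`, `1 < q < ∞`. -/
theorem lintegral_maximalFunction_rpow_le {q : ℝ} (hq : 1 < q) {h : ℝ → ℝ≥0∞}
    (hh : Measurable h) :
    ∫⁻ x, maximalFunction h x ^ q ≤
      (ENNReal.ofReal q * 10 * (2 ^ (q - 1) / ENNReal.ofReal (q - 1))) * ∫⁻ x, h x ^ q := by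
  have hq0 : 0 < q := by linarith
  have hq1 : 0 < q - 1 := by linarith
  have hM := measurable_maximalFunction h
  have hmul : ∀ y : ℝ≥0∞, y ^ q = ENNReal.ofReal q * (y ^ q / ENNReal.ofReal q) := fun y =>
    (ENNReal.mul_div_cancel (by simpa using hq0) ENNReal.ofReal_ne_top).symm
  calc ∫⁻ x, maximalFunction h x ^ q
      = ∫⁻ x, ENNReal.ofReal q * ∫⁻ t in Ioi (0 : ℝ), ENNReal.ofReal (t ^ (q - 1)) *
          (Ioi (ENNReal.ofReal t)).indicator 1 (maximalFunction h x) := by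
        refine lintegral_congr fun x => ?_
        rw [setLIntegral_rpow_indicator_Ioi hq0, ← hmul]
    _ = ENNReal.ofReal q * ∫⁻ t in Ioi (0 : ℝ), ∫⁻ x, ENNReal.ofReal (t ^ (q - 1)) *
          (Ioi (ENNReal.ofReal t)).indicator 1 (maximalFunction h x) := by
        rw [lintegral_const_mul' _ _ ENNReal.ofReal_ne_top]
        congr 1
        refine lintegral_lintegral_swap (f := fun x t => ENNReal.ofReal (t ^ (q - 1)) *
          (Ioi (ENNReal.ofReal t)).indicator 1 (maximalFunction h x)) (Measurable.aemeasurable ?_)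
        exact Measurable.mul (by fun_prop) (Measurable.indicator_Ioi (by fun_prop)
          (hM.comp measurable_fst))
    _ ≤ ENNReal.ofReal q * ∫⁻ t in Ioi (0 : ℝ), 10 * ∫⁻ x, h x *
          (ENNReal.ofReal (t ^ (q - 1 - 1)) *
            (Ioi (ENNReal.ofReal t)).indicator 1 (2 * h x)) := by
        gcongr ENNReal.ofReal q * ?_
        refine setLIntegral_mono' measurableSet_Ioi fun t ht => ?_
        have ht : 0 < t := ht
        have hset : ∀ x, (Ioi (ENNReal.ofReal t)).indicator (1 : ℝ≥0∞ → ℝ≥0∞)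
            (maximalFunction h x) =
            {x | ENNReal.ofReal t < maximalFunction h x}.indicator 1 x := fun x => by
          simp [indicator]
        -- One factor `t` is split off for the weak type bound; the remaining power `t^(q-2)` is
        -- integrable at `0` because `q > 1`.
        rw [lintegral_const_mul' _ _ ENNReal.ofReal_ne_top, lintegral_congr hset,
          lintegral_indicator_one (measurableSet_lt measurable_const hM),
          show t ^ (q - 1) = t ^ (q - 1 - 1) * t by
            rw [← Real.rpow_add_one ht.ne']; congr 1; ring,
          ENNReal.ofReal_mul (by positivity), mul_assoc]
        refine (mul_le_mul_right (volume_lt_maximalFunction_le h ht) _).trans_eq ?_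
        simp_rw [mul_left_comm (h _)]
        rw [lintegral_const_mul' _ _ ENNReal.ofReal_ne_top, mul_left_comm]
    _ = ENNReal.ofReal q * 10 * ∫⁻ x, ∫⁻ t in Ioi (0 : ℝ), h x *
          (ENNReal.ofReal (t ^ (q - 1 - 1)) *
            (Ioi (ENNReal.ofReal t)).indicator 1 (2 * h x)) := by
        rw [lintegral_const_mul' _ _ (by simp), mul_assoc]
        congr 2
        refine lintegral_lintegral_swap (f := fun t x => h x *
          (ENNReal.ofReal (t ^ (q - 1 - 1)) *
            (Ioi (ENNReal.ofReal t)).indicator 1 (2 * h x))) (Measurable.aemeasurable ?_)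
        exact Measurable.mul (by fun_prop) (Measurable.mul (by fun_prop)
          (Measurable.indicator_Ioi (by fun_prop) (by fun_prop)))
    _ = ENNReal.ofReal q * 10 * ∫⁻ x, 2 ^ (q - 1) / ENNReal.ofReal (q - 1) * h x ^ q := by
        congr 1
        refine lintegral_congr fun x => ?_
        rw [lintegral_const_mul]
        · rw [setLIntegral_rpow_indicator_Ioi hq1, ENNReal.mul_rpow_of_nonneg _ _ hq1.le,
            show h x ^ q = h x ^ (1 + (q - 1)) by congr 1; ring,
            ENNReal.rpow_add_of_nonneg _ _ zero_le_one hq1.le, ENNReal.rpow_one,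
            div_eq_mul_inv, div_eq_mul_inv]
          ring
        · exact Measurable.mul (by fun_prop)
            (Measurable.indicator_Ioi (by fun_prop) (by fun_prop))
    _ = _ := by
        rw [lintegral_const_mul _ (by fun_prop), mul_assoc _ _ (∫⁻ x, h x ^ q)]

/-! ### Kernels with cubic decay and their convolutions. -/

theorem intervalKernel_eq (φ : ℝ → ℂ) {a b : ℝ} (hab : a < b) (u : ℝ) :
    intervalKernel φ a b u = (b - a : ℝ) *
      (Complex.exp ((2 * Real.pi * ((a + b) / 2 * u) : ℝ) * Complex.I) * 𝓕⁻ φ ((b - a) * u)) := by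
  have hR : 0 < b - a := sub_pos.2 hab
  simp only [intervalKernel, Real.fourierInv_eq', intervalBump]
  set G : ℝ → ℂ := fun w => Complex.exp ((2 * Real.pi * inner ℝ w ((b - a) * u) : ℝ) * Complex.I) • φ w
    with hG
  have h1 : ∀ v : ℝ, Complex.exp ((2 * Real.pi * inner ℝ v u : ℝ) * Complex.I) •
      φ ((b - a)⁻¹ * (v - (a + b) / 2)) =
      Complex.exp ((2 * Real.pi * ((a + b) / 2 * u) : ℝ) * Complex.I) *
        G ((b - a)⁻¹ * (v - (a + b) / 2)) := by
    intro v
    simp only [hG, smul_eq_mul, ← mul_assoc, ← Complex.exp_add]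
    congr 2
    rw [← add_mul, ← Complex.ofReal_add]
    congr 2
    simp only [RCLike.inner_apply, conj_trivial]
    field_simp
    ring
  simp_rw [h1]
  rw [integral_const_mul, integral_sub_right_eq_self (fun v => G ((b - a)⁻¹ * v)),
    Measure.integral_comp_mul_left, inv_inv, abs_of_pos hR, Complex.real_smul]
  ring

theorem continuous_fourierInv_of_contDiff {φ : ℝ → ℂ} (hφ : ContDiff ℝ ∞ φ)
    (hc : HasCompactSupport φ) : Continuous (𝓕⁻ φ) := by
  have h := (𝓕⁻ (hc.toSchwartzMap hφ)).continuous
  rwa [SchwartzMap.fourierInv_coe] at h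

theorem exists_norm_fourierInv_le {φ : ℝ → ℂ} (hφ : ContDiff ℝ ∞ φ)
    (hc : HasCompactSupport φ) :
    ∃ D : ℝ, 0 ≤ D ∧ ∀ s, ‖𝓕⁻ φ s‖ ≤ D / (1 + |s|) ^ 3 := by
  set g := 𝓕⁻ (hc.toSchwartzMap hφ) with hg
  have hgφ : (g : ℝ → ℂ) = 𝓕⁻ φ := SchwartzMap.fourierInv_coe _
  refine ⟨2 ^ 3 * ((Finset.Iic (3, 0)).sup fun m => SchwartzMap.seminorm ℝ m.1 m.2) g,
    mul_nonneg (by norm_num) (apply_nonneg _ _), fun s => ?_⟩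
  have h := SchwartzMap.one_add_le_sup_seminorm_apply (𝕜 := ℝ) (m := (3, 0)) (k := 3) (n := 0)
    le_rfl le_rfl g s
  rw [norm_iteratedFDeriv_zero, Real.norm_eq_abs, hgφ] at h
  rw [le_div_iff₀ (by positivity), mul_comm]
  exact h

theorem integrable_const_div_one_add_abs_pow (D : ℝ) :
    Integrable (fun s : ℝ => D / (1 + |s|) ^ 3) := by
  have h := (integrable_one_add_norm (E := ℝ) (μ := volume) (r := 3) (by simp)).const_mul D
  refine h.congr (ae_of_all _ fun s => ?_)
  simp only [Real.norm_eq_abs]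
  rw [Real.rpow_neg (by positivity), div_eq_mul_inv]
  norm_cast

/-- Splitting at `|f| = 1` gives the majorant `w + B|f|^p`. -/
theorem MeasureTheory.MemLp.integrable_norm_mul_of_bounded {f : ℝ → ℂ} {p : ℝ≥0∞}
    (hf : MemLp f p volume) (hp : 1 ≤ p) (hp' : p ≠ ⊤) {w : ℝ → ℝ} (hw : Integrable w) {B : ℝ}
    (hw0 : ∀ t, 0 ≤ w t) (hB : ∀ t, w t ≤ B) : Integrable fun t => ‖f t‖ * w t := by
  have hfp := hf.integrable_norm_rpow (zero_lt_one.trans_le hp).ne' hp'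
  refine (hw.add (hfp.const_mul B)).mono' (hf.1.norm.mul hw.1) (ae_of_all _ fun t => ?_)
  have hp1 : 1 ≤ p.toReal := by
    rw [← ENNReal.toReal_one]
    exact ENNReal.toReal_mono hp' hp
  rw [Real.norm_of_nonneg (mul_nonneg (norm_nonneg _) (hw0 t)), Pi.add_apply]
  have hpos : 0 ≤ ‖f t‖ ^ p.toReal := by positivity
  rcases le_total ‖f t‖ 1 with h | h
  · nlinarith [hw0 t, hB t, mul_nonneg ((hw0 t).trans (hB t)) hpos]
  · have := Real.self_le_rpow_of_one_le h hp1
    nlinarith [hw0 t, hB t, mul_nonneg (sub_nonneg.2 (hB t)) hpos,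
      mul_nonneg (hw0 t) (sub_nonneg.2 this)]

section Convolution

variable {f k : ℝ → ℂ} {p : ℝ≥0∞} {D : ℝ}

theorem integrable_norm_mul_decay (hf : MemLp f p volume) (hp : 1 ≤ p) (hp' : p ≠ ⊤)
    (hD : 0 ≤ D) (x : ℝ) : Integrable fun t => ‖f t‖ * (D / (1 + |x - t|) ^ 3) := by
  refine hf.integrable_norm_mul_of_bounded hp hp'
    ((integrable_const_div_one_add_abs_pow D).comp_sub_left x) (B := D)
    (fun t => by positivity) fun t => div_le_self hD ?_
  exact one_le_pow₀ (by simp)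

theorem convolutionExists_of_decay (hf : MemLp f p volume) (hp : 1 ≤ p) (hp' : p ≠ ⊤)
    (hk : Continuous k) (hD : 0 ≤ D) (hkD : ∀ s, ‖k s‖ ≤ D / (1 + |s|) ^ 3) :
    ConvolutionExists f k (ContinuousLinearMap.mul ℂ ℂ) volume := by
  intro x
  refine (integrable_norm_mul_decay hf hp hp' hD x).mono'
    (hf.1.mul (hk.comp (continuous_const.sub continuous_id)).aestronglyMeasurable)
    (ae_of_all _ fun t => ?_)
  rw [ContinuousLinearMap.mul_apply', norm_mul]
  gcongr
  exact hkD _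

theorem continuous_convolution_of_decay (hf : MemLp f p volume) (hp : 1 ≤ p) (hp' : p ≠ ⊤)
    (hk : Continuous k) (hD : 0 ≤ D) (hkD : ∀ s, ‖k s‖ ≤ D / (1 + |s|) ^ 3) :
    Continuous (f ⋆[ContinuousLinearMap.mul ℂ ℂ, volume] k) := by
  refine continuous_iff_continuousAt.2 fun x₀ => ?_
  -- Moving `x` by less than `1` changes `1 + |x - t|` by a factor at most `2`, whose cube is `8`.
  refine continuousAt_of_dominated (bound := fun t => ‖f t‖ * (8 * D / (1 + |x₀ - t|) ^ 3))
    (.of_forall fun x => (convolutionExists_of_decay hf hp hp' hk hD hkD x).1) ?_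
    (integrable_norm_mul_decay hf hp hp' (by positivity) x₀) (ae_of_all _ fun t => ?_)
  · filter_upwards [Metric.ball_mem_nhds x₀ one_pos] with x hx
    refine ae_of_all _ fun t => ?_
    rw [ContinuousLinearMap.mul_apply', norm_mul]
    gcongr
    refine (hkD _).trans ?_
    rw [div_le_div_iff₀ (by positivity) (by positivity)]
    have h1 : 1 + |x₀ - t| ≤ 2 * (1 + |x - t|) := by
      rw [Metric.mem_ball, Real.dist_eq, abs_sub_comm] at hx
      linarith [abs_sub_le x₀ x t, abs_nonneg (x - t)]
    have h2 := pow_le_pow_left₀ (by positivity) h1 3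
    calc D * (1 + |x₀ - t|) ^ 3 ≤ D * (2 * (1 + |x - t|)) ^ 3 := by gcongr
      _ = 8 * D * (1 + |x - t|) ^ 3 := by ring
  · exact (continuous_const.mul (hk.comp (continuous_id.sub continuous_const))).continuousAt

end Convolution

/-! ### Frequency pieces as Fourier integrals, and orthogonality on unit cells. -/

/-- The centre is `R(j + α/R + 1/2)`, so after rescaling `j` survives only in a 1-periodic
character. -/
theorem freqPiece_eq (φ f : ℝ → ℂ) {R : ℝ} (hR : 0 < R) (α : ℝ) (j : ℤ) (x : ℝ) :
    freqPiece φ f (α + j * R) (α + (j + 1) * R) x =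
      ∫ s : ℝ, Complex.exp (2 * Real.pi * Complex.I * j * s) *
        (f (x - R⁻¹ * s) * (Complex.exp ((2 * Real.pi * ((α / R + 1 / 2) * s) : ℝ) * Complex.I) *
          𝓕⁻ φ s)) := by
  have hlt : α + j * R < α + (j + 1) * R := by nlinarith
  set H : ℝ → ℂ := fun s => Complex.exp (2 * Real.pi * Complex.I * j * s) *
        (f (x - R⁻¹ * s) * (Complex.exp ((2 * Real.pi * ((α / R + 1 / 2) * s) : ℝ) * Complex.I) *
          𝓕⁻ φ s)) with hH
  have h1 : freqPiece φ f (α + j * R) (α + (j + 1) * R) x =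
      ∫ t, (fun u => (R : ℂ) * H (R * u)) (x - t) := by
    simp only [freqPiece, convolution, ContinuousLinearMap.mul_apply']
    refine integral_congr_ae (ae_of_all _ fun t => ?_)
    dsimp only
    rw [intervalKernel_eq φ hlt, show α + (j + 1) * R - (α + j * R) = R by ring, hH]
    dsimp only
    rw [inv_mul_cancel_left₀ hR.ne', sub_sub_cancel]
    have : Complex.exp ((2 * Real.pi * ((α + j * R + (α + (j + 1) * R)) / 2 * (x - t)) : ℝ) *
        Complex.I) = Complex.exp (2 * Real.pi * Complex.I * j * (R * (x - t) : ℝ)) *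
        Complex.exp ((2 * Real.pi * ((α / R + 1 / 2) * (R * (x - t))) : ℝ) * Complex.I) := by
      rw [← Complex.exp_add]
      congr 1
      have : (R : ℂ) ≠ 0 := by exact_mod_cast hR.ne'
      push_cast
      field_simp
      ring
    rw [this]
    ring
  rw [h1, integral_sub_left_eq_self (fun u => (R : ℂ) * H (R * u)), integral_const_mul, Measure.integral_comp_mul_left,
    abs_of_pos (inv_pos.2 hR), Complex.real_smul, ← mul_assoc, ← Complex.ofReal_mul,
    mul_inv_cancel₀ hR.ne', Complex.ofReal_one, one_mul]

theorem ENNReal.sq_tsum_le_tsum_inv_mul_tsum {ι : Type*} {w b : ι → ℝ≥0∞}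
    (hw0 : ∀ i, w i ≠ 0) (hw : ∀ i, w i ≠ ⊤) :
    (∑' i, b i) ^ 2 ≤ (∑' i, (w i)⁻¹) * ∑' i, w i * b i ^ 2 := by
  let _ : MeasurableSpace ι := ⊤
  have h := ENNReal.lintegral_mul_le_Lp_mul_Lq (Measure.count : Measure ι)
    (p := 2) (q := 2) (Real.HolderConjugate.two_two)
    (f := fun i => (w i)⁻¹ ^ (1 / 2 : ℝ)) (g := fun i => w i ^ (1 / 2 : ℝ) * b i)
    measurable_from_top.aemeasurable measurable_from_top.aemeasurable
  simp only [lintegral_count, Pi.mul_apply] at h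
  have h1 : ∀ i, (w i)⁻¹ ^ (1 / 2 : ℝ) * (w i ^ (1 / 2 : ℝ) * b i) = b i := fun i => by
    rw [← mul_assoc, ← ENNReal.mul_rpow_of_nonneg _ _ (by norm_num),
      ENNReal.inv_mul_cancel (hw0 i) (hw i), ENNReal.one_rpow, one_mul]
  have h2 : ∀ y : ℝ≥0∞, (y ^ (1 / 2 : ℝ)) ^ (2 : ℝ) = y := fun y => by
    rw [← ENNReal.rpow_mul]; norm_num
  simp only [h1, ENNReal.mul_rpow_of_nonneg _ _ (zero_le_two (α := ℝ)), h2] at h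
  calc (∑' i, b i) ^ 2 ≤ _ := pow_le_pow_left' h 2
    _ = _ := by
      rw [mul_pow, ← ENNReal.rpow_two, ← ENNReal.rpow_two, h2, h2]
      simp only [ENNReal.rpow_two]

theorem tsum_sq_enorm_setIntegral_exp_mul {G : ℝ → ℂ} (n : ℤ)
    (hG : MemLp G 2 (volume.restrict (Ioc (n : ℝ) (n + 1)))) :
    ∑' j : ℤ, ‖∫ s in Ioc (n : ℝ) (n + 1),
      Complex.exp (2 * Real.pi * Complex.I * j * s) * G s‖ₑ ^ 2 =
      ∫⁻ s in Ioc (n : ℝ) (n + 1), ‖G s‖ₑ ^ 2 := by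
  have hlt : (n : ℝ) < n + 1 := by linarith
  have h := hasSum_sq_fourierCoeffOn hlt hG
  have hsub : (n : ℝ) + 1 - n = 1 := by ring
  rw [hsub, inv_one, one_smul, intervalIntegral.integral_of_le hlt.le] at h
  -- Fourier coefficients carry `e^{-2πijs}`, hence the reflection of `ℤ`.
  have hc : ∀ j : ℤ, fourierCoeffOn hlt G (-j) = ∫ s in Ioc (n : ℝ) (n + 1),
      Complex.exp (2 * Real.pi * Complex.I * j * s) * G s := fun j => by
    rw [fourierCoeffOn_eq_integral, intervalIntegral.integral_of_le hlt.le, hsub, div_one, one_smul]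
    refine setIntegral_congr_fun measurableSet_Ioc fun s _ => ?_
    rw [fourier_coe_apply, neg_neg, Complex.ofReal_one, div_one, smul_eq_mul]
  have hint : Integrable (fun s => ‖G s‖ ^ 2) (volume.restrict (Ioc (n : ℝ) (n + 1))) :=
    hG.norm.integrable_sq
  have h' := ((Equiv.neg ℤ).hasSum_iff.2 h).tsum_eq
  have hs := (Equiv.neg ℤ).summable_iff.2 h.summable
  simp only [Function.comp_def, Equiv.neg_apply, hc] at h' hs
  calc _ = ∑' j : ℤ, ENNReal.ofReal (‖∫ s in Ioc (n : ℝ) (n + 1),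
      Complex.exp (2 * Real.pi * Complex.I * j * s) * G s‖ ^ 2) := by
        simp only [ENNReal.ofReal_pow (norm_nonneg _), ofReal_norm]
    _ = _ := by
        rw [← ENNReal.ofReal_tsum_of_nonneg (fun _ => by positivity) hs, h',
          ofReal_integral_eq_lintegral_ofReal hint (ae_of_all _ fun _ => by positivity)]
        simp only [ENNReal.ofReal_pow (norm_nonneg _), ofReal_norm]

theorem tsum_sq_enorm_integral_exp_mul_le {G : ℝ → ℂ} (hG : Integrable G)
    (hG2 : ∀ n : ℤ, MemLp G 2 (volume.restrict (Ioc (n : ℝ) (n + 1))))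
    {w : ℤ → ℝ≥0∞} (hw0 : ∀ i, w i ≠ 0) (hw : ∀ i, w i ≠ ⊤) :
    ∑' j : ℤ, ‖∫ s : ℝ, Complex.exp (2 * Real.pi * Complex.I * j * s) * G s‖ₑ ^ 2 ≤
      (∑' n, (w n)⁻¹) * ∑' n : ℤ, w n * ∫⁻ s in Ioc (n : ℝ) (n + 1), ‖G s‖ₑ ^ 2 := by
  have hexp : ∀ j : ℤ, Integrable
      fun s : ℝ => Complex.exp (2 * Real.pi * Complex.I * j * s) * G s := fun j => by
    refine hG.bdd_mul (c := 1) (by fun_prop) (ae_of_all _ fun s => ?_)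
    rw [show 2 * Real.pi * Complex.I * j * s = (2 * Real.pi * j * s : ℝ) * Complex.I by
      push_cast; ring, Complex.norm_exp_ofReal_mul_I]
  have hsplit : ∀ j : ℤ, ‖∫ s : ℝ, Complex.exp (2 * Real.pi * Complex.I * j * s) * G s‖ₑ ≤
      ∑' n : ℤ, ‖∫ s in Ioc (n : ℝ) (n + 1),
        Complex.exp (2 * Real.pi * Complex.I * j * s) * G s‖ₑ := fun j => by
    have h := hasSum_integral_iUnion (μ := volume) (s := fun n : ℤ => Ioc (n : ℝ) (n + 1))
      (fun _ => measurableSet_Ioc) (Set.pairwise_disjoint_Ioc_intCast ℝ) (hexp j).integrableOn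
    rw [iUnion_Ioc_intCast, setIntegral_univ] at h
    rw [← h.tsum_eq]
    exact enorm_tsum_le_tsum_enorm
  calc _ ≤ ∑' j : ℤ, (∑' n, (w n)⁻¹) * ∑' n : ℤ, w n * ‖∫ s in Ioc (n : ℝ) (n + 1),
        Complex.exp (2 * Real.pi * Complex.I * j * s) * G s‖ₑ ^ 2 := by
        gcongr with j
        exact (pow_le_pow_left' (hsplit j) 2).trans (ENNReal.sq_tsum_le_tsum_inv_mul_tsum hw0 hw)
    _ = _ := by
        rw [ENNReal.tsum_mul_left, ENNReal.tsum_comm]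
        congr 2
        funext n
        rw [ENNReal.tsum_mul_left, tsum_sq_enorm_setIntegral_exp_mul n (hG2 n)]

/-! ### Pointwise domination by the maximal function of `|f|²`. -/

theorem lintegral_comp_sub_inv_mul {R : ℝ} (hR : 0 < R) (F : ℝ → ℝ≥0∞) (x : ℝ) :
    ∫⁻ s, F (x - R⁻¹ * s) = ENNReal.ofReal R * ∫⁻ y, F y := by
  have hR' : R⁻¹ ≠ 0 := (inv_pos.2 hR).ne'
  have h := (measurableEmbedding_mulLeft₀ hR').lintegral_map (μ := volume) fun y => F (x - y)
  rw [← h, Real.map_volume_mul_left hR', lintegral_smul_measure, inv_inv, abs_of_pos hR,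
    lintegral_sub_left_eq_self]
  rfl

theorem setLIntegral_comp_sub_inv_mul_le {R : ℝ} (hR : 0 < R) (h : ℝ → ℝ≥0∞) (x : ℝ) (n : ℤ) :
    ∫⁻ s in Ioc (n : ℝ) (n + 1), h (x - R⁻¹ * s) ≤
      ENNReal.ofReal (4 * (1 + |(n : ℝ)|)) * maximalFunction h x := by
  -- On the cell `|s| < |n| + 2`; the ball has length `2(|n| + 2)/R`, and the Jacobian `R` cancels
  -- the scale.
  have hr : 0 < R⁻¹ * (|(n : ℝ)| + 2) := by positivity
  calc ∫⁻ s in Ioc (n : ℝ) (n + 1), h (x - R⁻¹ * s)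
      ≤ ∫⁻ s, (Metric.ball x (R⁻¹ * (|(n : ℝ)| + 2))).indicator h (x - R⁻¹ * s) := by
        rw [← lintegral_indicator measurableSet_Ioc]
        refine lintegral_mono fun s => ?_
        by_cases hs : s ∈ Ioc (n : ℝ) (n + 1)
        · rw [indicator_of_mem hs, indicator_of_mem]
          rw [Metric.mem_ball, Real.dist_eq, sub_sub_cancel_left, abs_neg, abs_mul,
            abs_of_pos (inv_pos.2 hR)]
          gcongr
          rw [abs_lt]
          constructor <;> linarith [hs.1, hs.2, neg_abs_le (n : ℝ), le_abs_self (n : ℝ)]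
        · simp [hs]
    _ = ENNReal.ofReal R * ∫⁻ y in Metric.ball x (R⁻¹ * (|(n : ℝ)| + 2)), h y := by
        rw [lintegral_comp_sub_inv_mul hR, lintegral_indicator Metric.isOpen_ball.measurableSet]
    _ ≤ ENNReal.ofReal R * (ENNReal.ofReal (2 * (R⁻¹ * (|(n : ℝ)| + 2))) *
          maximalFunction h x) := by
        gcongr
        exact setLIntegral_ball_le_maximalFunction h hr (Metric.mem_ball_self hr)
    _ ≤ _ := by
        rw [← mul_assoc, ← ENNReal.ofReal_mul hR.le]
        refine mul_le_mul_left (ENNReal.ofReal_le_ofReal ?_) _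
        rw [mul_left_comm R, mul_inv_cancel_left₀ hR.ne']
        linarith [abs_nonneg (n : ℝ)]

theorem MeasureTheory.MemLp.comp_sub_mul {f : ℝ → ℂ} {p : ℝ≥0∞} (hf : MemLp f p volume) {c : ℝ}
    (hc : c ≠ 0) (x : ℝ) : MemLp (fun s => f (x - c * s)) p volume := by
  have h1 : MemLp (fun y => f (x - y)) p volume :=
    hf.comp_measurePreserving (volume.measurePreserving_sub_left x)
  refine MemLp.comp_of_map (f := fun s => c * s) (g := fun y => f (x - y)) ?_
    (by fun_prop)
  rw [Real.map_volume_mul_left hc]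
  exact h1.smul_measure ENNReal.ofReal_ne_top

theorem sq_shiftedSquareFunction_le {φ f : ℝ → ℂ} {p : ℝ≥0∞} (hf : MemLp f p volume)
    (hp : 2 ≤ p) (hp' : p ≠ ⊤) (hK : Continuous (𝓕⁻ φ)) {D : ℝ} (hD : 0 ≤ D)
    (hKD : ∀ s, ‖𝓕⁻ φ s‖ ≤ D / (1 + |s|) ^ 3) {R : ℝ} (hR : 0 < R) (α x : ℝ) :
    shiftedSquareFunction φ f R α x ^ 2 ≤
      ENNReal.ofReal (256 * D ^ 2) * (∑' n : ℤ, (ENNReal.ofReal ((1 + |(n : ℝ)|) ^ 2))⁻¹) ^ 2 *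
        maximalFunction (fun y => ‖f y‖ₑ ^ 2) x := by
  have hp1 : 1 ≤ p := one_le_two.trans hp
  set e : ℝ → ℂ := fun s => Complex.exp ((2 * Real.pi * ((α / R + 1 / 2) * s) : ℝ) * Complex.I) *
    𝓕⁻ φ s with he
  have hec : Continuous e := by fun_prop
  have hen : ∀ s, ‖e s‖ ≤ D / (1 + |s|) ^ 3 := fun s => by
    rw [he, norm_mul, Complex.norm_exp_ofReal_mul_I, one_mul]
    exact hKD s
  set g : ℝ → ℂ := fun s => f (x - R⁻¹ * s) with hg
  have hgp : MemLp g p volume := hf.comp_sub_mul (inv_pos.2 hR).ne' x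
  have hG : Integrable fun s => g s * e s := by
    have h := integrable_norm_mul_decay hgp hp1 hp' hD 0
    refine h.mono' (hgp.1.mul hec.aestronglyMeasurable) (ae_of_all _ fun s => ?_)
    rw [norm_mul, zero_sub, abs_neg]
    gcongr
    exact hen s
  have hG2 : ∀ n : ℤ, MemLp (fun s => g s * e s) 2 (volume.restrict (Ioc (n : ℝ) (n + 1))) := by
    intro n
    have h2 : MemLp g 2 (volume.restrict (Ioc (n : ℝ) (n + 1))) :=
      (hgp.restrict _).mono_exponent hp
    refine (h2.norm.mul_const D).mono (hG.1.restrict) (ae_of_all _ fun s => ?_)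
    rw [norm_mul, norm_mul (‖g s‖), norm_norm, Real.norm_of_nonneg hD]
    gcongr
    exact (hen s).trans (div_le_self hD (one_le_pow₀ (by simp)))
  have hw : ∀ n : ℤ, ENNReal.ofReal ((1 + |(n : ℝ)|) ^ 2) ≠ 0 := fun n => by
    simp only [ne_eq, ENNReal.ofReal_eq_zero, not_le]
    positivity
  -- With `N = 1 + |n|`, weight, squared decay and ball size give `N² · (8D/N³)² · 4N = 256D²/N³ ≤
  -- 256D²/N²`. The inverse weight thus reappears, which is why its sum enters squared.
  have hpiece : ∀ n : ℤ, ENNReal.ofReal ((1 + |(n : ℝ)|) ^ 2) *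
      ∫⁻ s in Ioc (n : ℝ) (n + 1), ‖g s * e s‖ₑ ^ 2 ≤
      ENNReal.ofReal (256 * D ^ 2) * (ENNReal.ofReal ((1 + |(n : ℝ)|) ^ 2))⁻¹ *
        maximalFunction (fun y => ‖f y‖ₑ ^ 2) x := by
    intro n
    set N : ℝ := 1 + |(n : ℝ)| with hN
    have hN1 : 1 ≤ N := by simp [hN]
    have hN0 : 0 < N := by linarith
    have hpt : ∀ s ∈ Ioc (n : ℝ) (n + 1), ‖g s * e s‖ₑ ^ 2 ≤
        ENNReal.ofReal ((8 * D / N ^ 3) ^ 2) * ‖f (x - R⁻¹ * s)‖ₑ ^ 2 := by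
      intro s hs
      have hes : ‖e s‖ ≤ 8 * D / N ^ 3 := by
        refine (hen s).trans ?_
        rw [div_le_div_iff₀ (by positivity) (by positivity)]
        have h1 : N ≤ 2 * (1 + |s|) := by
          have : |(n : ℝ)| ≤ |s| + 1 := by
            rw [abs_le]
            constructor <;> linarith [hs.1, hs.2, neg_abs_le s, le_abs_self s]
          linarith [abs_nonneg s]
        calc D * N ^ 3 ≤ D * (2 * (1 + |s|)) ^ 3 := by gcongr
          _ = 8 * D * (1 + |s|) ^ 3 := by ring
      rw [enorm_mul, mul_pow, mul_comm, ENNReal.ofReal_pow (by positivity)]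
      gcongr
      rw [← ofReal_norm]
      exact ENNReal.ofReal_le_ofReal hes
    calc ENNReal.ofReal (N ^ 2) * ∫⁻ s in Ioc (n : ℝ) (n + 1), ‖g s * e s‖ₑ ^ 2
        ≤ ENNReal.ofReal (N ^ 2) * (ENNReal.ofReal ((8 * D / N ^ 3) ^ 2) *
            (ENNReal.ofReal (4 * N) * maximalFunction (fun y => ‖f y‖ₑ ^ 2) x)) := by
          gcongr
          refine (setLIntegral_mono' measurableSet_Ioc hpt).trans ?_
          rw [lintegral_const_mul' _ _ ENNReal.ofReal_ne_top]
          gcongr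
          exact setLIntegral_comp_sub_inv_mul_le hR (fun y => ‖f y‖ₑ ^ 2) x n
      _ = ENNReal.ofReal (256 * D ^ 2 * (N ^ 3)⁻¹) *
            maximalFunction (fun y => ‖f y‖ₑ ^ 2) x := by
          rw [← mul_assoc, ← mul_assoc, ← ENNReal.ofReal_mul (by positivity),
            ← ENNReal.ofReal_mul (by positivity)]
          congr 2
          field_simp
          ring
      _ ≤ _ := by
          rw [← ENNReal.ofReal_inv_of_pos (by positivity), ← ENNReal.ofReal_mul (by positivity)]
          gcongr 2
          gcongr
          norm_num
  have hsq : shiftedSquareFunction φ f R α x ^ 2 =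
      ∑' j : ℤ, ‖∫ s : ℝ, Complex.exp (2 * Real.pi * Complex.I * j * s) * (g s * e s)‖ₑ ^ 2 := by
    rw [shiftedSquareFunction, ← ENNReal.rpow_two, ← ENNReal.rpow_mul, one_div_mul_cancel two_ne_zero,
      ENNReal.rpow_one]
    simp only [freqPiece_eq φ f hR α _ x, hg, he]
  rw [hsq]
  refine (tsum_sq_enorm_integral_exp_mul_le hG hG2 hw fun _ => ENNReal.ofReal_ne_top).trans ?_
  refine (mul_le_mul_right (ENNReal.tsum_le_tsum hpiece) _).trans_eq ?_
  rw [ENNReal.tsum_mul_right, ENNReal.tsum_mul_left]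
  ring

theorem tsum_inv_sq_one_add_abs_ne_top :
    ∑' n : ℤ, (ENNReal.ofReal ((1 + |(n : ℝ)|) ^ 2))⁻¹ ≠ ⊤ := by
  have hpos : ∀ n : ℤ, 0 < (1 + |(n : ℝ)|) ^ 2 := fun n => by positivity
  simp only [← ENNReal.ofReal_inv_of_pos (hpos _)]
  refine Summable.tsum_ofReal_ne_top ?_
  have h : Summable fun n : ℕ => ((1 + |(n : ℝ)|) ^ 2)⁻¹ := by
    have := (summable_nat_add_iff 1).2 (Real.summable_nat_pow_inv.2 one_lt_two)
    refine this.congr fun n => ?_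
    rw [Nat.abs_cast]
    push_cast
    rw [add_comm]
  refine Summable.of_nat_of_neg ?_ ?_
  · simpa using h
  · simpa using h

/-! ### Measurability, the supremum, and the `L^p` bound. -/

section Interval

variable {φ : ℝ → ℂ}

theorem contDiff_intervalBump (hφ : ContDiff ℝ ∞ φ) (a b : ℝ) : ContDiff ℝ ∞ (intervalBump φ a b) :=
  hφ.comp (contDiff_const.mul (contDiff_id.sub contDiff_const))

theorem hasCompactSupport_intervalBump (hφ : HasCompactSupport φ) {a b : ℝ} (hab : a < b) :
    HasCompactSupport (intervalBump φ a b) :=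
  hφ.comp_homeomorph ((Homeomorph.subRight ((a + b) / 2)).trans
    (Homeomorph.mulLeft₀ (b - a)⁻¹ (inv_pos.2 (sub_pos.2 hab)).ne'))

/-- The supremum is uncountable, so measurability comes from lower semicontinuity, each frequency
piece being continuous. -/
theorem lowerSemicontinuous_restrictedVariation (hφ : ContDiff ℝ ∞ φ) (hc : HasCompactSupport φ)
    {f : ℝ → ℂ} {p : ℝ≥0∞} (hf : MemLp f p volume) (hp : 1 ≤ p) (hp' : p ≠ ⊤) :
    LowerSemicontinuous (restrictedVariation φ f) := by
  refine lowerSemicontinuous_iSup fun R => lowerSemicontinuous_iSup fun hR =>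
    lowerSemicontinuous_iSup fun α => lowerSemicontinuous_iSup fun _ => ?_
  have hsum : LowerSemicontinuous fun x =>
      ∑' j : ℤ, ‖freqPiece φ f (α + j * R) (α + (j + 1) * R) x‖ₑ ^ 2 := by
    refine lowerSemicontinuous_tsum fun j => Continuous.lowerSemicontinuous ?_
    have hlt : α + j * R < α + (j + 1) * R := by nlinarith
    have hc' := hasCompactSupport_intervalBump hc hlt
    have hs := contDiff_intervalBump hφ (α + j * R) (α + (j + 1) * R)
    obtain ⟨D, hD, hKD⟩ := exists_norm_fourierInv_le hs hc'
    have hcont : Continuous (freqPiece φ f (α + j * R) (α + (j + 1) * R)) :=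
      continuous_convolution_of_decay hf hp hp' (continuous_fourierInv_of_contDiff hs hc') hD hKD
    exact (ENNReal.continuous_pow 2).comp hcont.enorm
  exact ENNReal.continuous_rpow_const.comp_lowerSemicontinuous hsum
    (ENNReal.monotone_rpow_of_nonneg (by norm_num))

theorem exists_restrictedVariation_le (hφ : ContDiff ℝ ∞ φ) (hc : HasCompactSupport φ) :
    ∃ A : ℝ≥0∞, A ≠ ⊤ ∧ ∀ (f : ℝ → ℂ) (p : ℝ≥0∞), MemLp f p volume → 2 ≤ p → p ≠ ⊤ → ∀ x,
      restrictedVariation φ f x ≤ (A * maximalFunction (fun y => ‖f y‖ₑ ^ 2) x) ^ (1 / 2 : ℝ) := by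
  obtain ⟨D, hD, hKD⟩ := exists_norm_fourierInv_le hφ hc
  refine ⟨ENNReal.ofReal (256 * D ^ 2) *
    (∑' n : ℤ, (ENNReal.ofReal ((1 + |(n : ℝ)|) ^ 2))⁻¹) ^ 2, ENNReal.mul_ne_top ENNReal.ofReal_ne_top
    (ENNReal.pow_ne_top tsum_inv_sq_one_add_abs_ne_top), fun f p hf hp hp' x => ?_⟩
  refine iSup_le fun R => iSup_le fun hR => iSup_le fun α => iSup_le fun _ => ?_
  rw [one_div, ENNReal.le_rpow_inv_iff two_pos, ENNReal.rpow_two]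
  exact sq_shiftedSquareFunction_le hf hp hp' (continuous_fourierInv_of_contDiff hφ hc) hD hKD hR α x

end Interval

/-- The maximal function sees only the a.e. class of `f`, so a measurable representative can be
used. -/
theorem exists_lintegral_maximalFunction_sq_rpow_le {r : ℝ} (hr : 2 < r) :
    ∃ B : ℝ≥0∞, B ≠ ⊤ ∧ ∀ f : ℝ → ℂ, AEStronglyMeasurable f volume →
      ∫⁻ x, maximalFunction (fun y => ‖f y‖ₑ ^ 2) x ^ (r / 2) ≤ B * ∫⁻ x, ‖f x‖ₑ ^ r := by
  have hq : 1 < r / 2 := by linarith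
  refine ⟨ENNReal.ofReal (r / 2) * 10 * (2 ^ (r / 2 - 1) / ENNReal.ofReal (r / 2 - 1)),
    ?_, fun f hf => ?_⟩
  rotate_left
  · have hae : (fun y => ‖f y‖ₑ ^ 2) =ᵐ[volume] fun y => ‖hf.mk f y‖ₑ ^ 2 := by
      filter_upwards [hf.ae_eq_mk] with y hy
      rw [hy]
    rw [maximalFunction_congr_ae hae]
    refine (lintegral_maximalFunction_rpow_le hq
      (hf.stronglyMeasurable_mk.enorm.pow_const 2)).trans_eq ?_
    congr 1
    refine lintegral_congr_ae ?_
    filter_upwards [hf.ae_eq_mk] with y hy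
    rw [← hy, ← ENNReal.rpow_two, ← ENNReal.rpow_mul]
    congr 1
    ring
  · refine ENNReal.mul_ne_top (ENNReal.mul_ne_top ENNReal.ofReal_ne_top (by simp))
      (ENNReal.div_ne_top (ENNReal.rpow_ne_top_of_nonneg (by linarith) (by simp)) ?_)
    simpa using hq

theorem mainTheorem5 (φ : ℝ → ℂ) (hφ : ContDiff ℝ ∞ φ)
    (hsupp : Function.support φ ⊆ Icc (-1 / 2) (1 / 2))
    (p : ℝ≥0∞) (hp : 2 < p) (hp' : p < ⊤) :
    ∃ C : ℝ≥0, ∀ f : ℝ → ℂ, MemLp f p volume →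
      (∀ a b : ℝ, a < b →
        ConvolutionExists f (intervalKernel φ a b) (ContinuousLinearMap.mul ℂ ℂ) volume) ∧
      MemLp (restrictedVariation φ f) p volume ∧
      eLpNorm (restrictedVariation φ f) p volume ≤ C * eLpNorm f p volume := by
  have hc : HasCompactSupport φ := HasCompactSupport.of_support_subset_isCompact isCompact_Icc hsupp
  have hp1 : 1 ≤ p := one_le_two.trans hp.le
  have hp0 : p ≠ 0 := (zero_lt_one.trans_le hp1).ne'
  have hr : 2 < p.toReal := by
    simpa using (ENNReal.toReal_lt_toReal (by simp) hp'.ne).2 hp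
  obtain ⟨A, hA, hVA⟩ := exists_restrictedVariation_le hφ hc
  obtain ⟨B, hB, hMB⟩ := exists_lintegral_maximalFunction_sq_rpow_le hr
  set r := p.toReal with hrp
  have hr0 : 0 < r := by linarith
  have hCtop : A ^ (1 / 2 : ℝ) * B ^ (1 / r) ≠ ⊤ := ENNReal.mul_ne_top
    (ENNReal.rpow_ne_top_of_nonneg (by norm_num) hA)
    (ENNReal.rpow_ne_top_of_nonneg (by positivity) hB)
  refine ⟨(A ^ (1 / 2 : ℝ) * B ^ (1 / r)).toNNReal, fun f hf => ?_⟩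
  have hbound : eLpNorm (restrictedVariation φ f) p volume ≤
      (A ^ (1 / 2 : ℝ) * B ^ (1 / r)).toNNReal * eLpNorm f p volume := by
    rw [ENNReal.coe_toNNReal hCtop, eLpNorm_eq_lintegral_rpow_enorm_toReal hp0 hp'.ne,
      eLpNorm_eq_lintegral_rpow_enorm_toReal hp0 hp'.ne, ← hrp]
    simp only [enorm_eq_self]
    have hle : ∫⁻ x, restrictedVariation φ f x ^ r ≤
        A ^ (r / 2) * (B * ∫⁻ x, ‖f x‖ₑ ^ r) := by
      calc ∫⁻ x, restrictedVariation φ f x ^ r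
          ≤ ∫⁻ x, A ^ (r / 2) * maximalFunction (fun y => ‖f y‖ₑ ^ 2) x ^ (r / 2) := by
            refine lintegral_mono fun x => ?_
            refine (ENNReal.rpow_le_rpow (hVA f p hf hp.le hp'.ne x) hr0.le).trans_eq ?_
            rw [← ENNReal.rpow_mul, ← ENNReal.mul_rpow_of_nonneg _ _ (by positivity)]
            congr 1
            ring
        _ = A ^ (r / 2) * ∫⁻ x, maximalFunction (fun y => ‖f y‖ₑ ^ 2) x ^ (r / 2) :=
            lintegral_const_mul' _ _ (ENNReal.rpow_ne_top_of_nonneg (by positivity) hA)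
        _ ≤ _ := by
            gcongr
            exact hMB f hf.1
    refine (ENNReal.rpow_le_rpow hle (by positivity)).trans_eq ?_
    rw [ENNReal.mul_rpow_of_nonneg _ _ (by positivity), ENNReal.mul_rpow_of_nonneg _ _ (by positivity),
      ← ENNReal.rpow_mul, show r / 2 * (1 / r) = 1 / 2 by field_simp, mul_assoc]
  refine ⟨fun a b hab => ?_, ⟨?_, ?_⟩, hbound⟩
  · have hc' := hasCompactSupport_intervalBump hc hab
    have hs := contDiff_intervalBump hφ a b
    obtain ⟨D, hD, hKD⟩ := exists_norm_fourierInv_le hs hc'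
    exact convolutionExists_of_decay hf hp1 hp'.ne (continuous_fourierInv_of_contDiff hs hc') hD hKD
  · exact (lowerSemicontinuous_restrictedVariation hφ hc hf hp1
      hp'.ne).measurable.aestronglyMeasurable
  · exact hbound.trans_lt (ENNReal.mul_lt_top ENNReal.coe_lt_top hf.2)
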